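/- Let $(S,d)$ be a locally compact, separable, unbounded metric space, and write $B(x,r)=\{y\in S: d(x,y)<r\}$. Assume that $S$ is doubling (there is $N\in\mathbb N$ such that every ball $B(x,r)$ can be covered by at most $N$ balls of radius $r/2$) and $\sigma$-uniformly perfect for some $\sigma>1$ (that is, $B(x,\sigma r)\setminus B(x,r)\neq\emptyset$ for all $x\in S$ and $r>0$). Let $\mu$ be a Borel measure on $S$ with $\mu(S)=\infty$ that is boundedly finite (bounded Borel sets have finite measure), and suppose that there are $C_V\ge 1$ and $s>0$ such that $\mu(B(x,r))\le C_V r^s$ for all $x\in S$ and $r>0$. Let $\rho$ be a probability measure on $(0,\infty)$. For $\lambda>0$ let $\xi=\xi_\lambda$ be a Poisson point process on $S\times(0,\infty)$ with intensity measure $(\lambda\mu)\otimes\rho$: a random counting measure such that $\xi(A)$ is Poisson distributed with parameter $(\lambda\mu\otimes\rho)(A)$ for every Borel set $A$ (with $\xi(A)=\infty$ almost surely if the parameter is $\infty$), and $\xi(A_1),\dots,\xi(A_n)$ are independent for pairwise disjoint Borel sets $A_1,\dots,A_n$. Write $\mathbb P_\lambda$ and $\mathbb E_\lambda$ for the corresponding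 probability and expectation. For $x,y\in S$ write $x\leftrightarrow y$ if there are finitely many points $(z_0,R_0),\dots,(z_n,R_n)$ in the support of $\xi$, $n\ge 0$, with $x\in B(z_0,R_0)$, $y\in B(z_n,R_n)$ and $B(z_{i-1},R_{i-1})\cap B(z_i,R_i)\ne\emptyset$ for $1\le i\le n$. Let $M(x)=\sup\{d(x,y): y\in S,\ x\leftrightarrow y\}\in[0,\infty]$, where $\sup\emptyset=0$. (1) If $\int_0^\infty R^s\,\rho(dR)<\infty$, then there exists $\lambda_0>0$ such that for all $\lambda\in(0,\lambda_0)$ $$\lim_{r\to\infty}\ \sup_{x\in S}\ \mathbb P_\lambda\bigl(M(x)>r\bigr)=0 .$$ (2) For every $\beta>0$: if $\int_0^\infty R^{s+\beta}\,\rho(dR)<\infty$, then there exists $\lambda_0>0$ such that for all $\lambda\in(0,\lambda_0)$ $$\sup_{x\in S}\ \mathbb E_\lambda\bigl[M(x)^\beta\bigr]<\infty .$$ -/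

import Mathlib

open MeasureTheory ProbabilityTheory Filter Topology
open scoped ENNReal NNReal

noncomputable section

namespace BooleanPercolation

/-- A metric space is doubling if for some `N` every ball of radius `r` is covered by at most
`N` balls of radius `r / 2`. -/
def IsDoublingSpace (S : Type*) [MetricSpace S] : Prop :=
  ∃ N : ℕ, ∀ (x : S) (r : ℝ), 0 < r →
    ∃ t : Finset S, t.card ≤ N ∧ Metric.ball x r ⊆ ⋃ y ∈ t, Metric.ball y (r / 2)

/-- `σ`-uniform perfectness: all the annuli `B(x, σ r) \ B(x, r)` are nonempty. -/
def IsUniformlyPerfect (S : Type*) [MetricSpace S] (σ : ℝ) : Prop :=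
  ∀ (x : S) (r : ℝ), 0 < r → (Metric.ball x (σ * r) \ Metric.ball x r).Nonempty

/-- A measure is boundedly finite if bounded Borel sets have finite measure. -/
def IsBoundedlyFinite {S : Type*} [MetricSpace S] [MeasurableSpace S] (μ : Measure S) : Prop :=
  ∀ A : Set S, MeasurableSet A → Bornology.IsBounded A → μ A < ∞

/-- The Poisson distribution with parameter `t ∈ [0, ∞]`, as a measure on `[0, ∞]`; the Poisson
distribution with parameter `∞` is the point mass at `∞`. -/
def poissonLaw (t : ℝ≥0∞) : Measure ℝ≥0∞ :=
  if t = ∞ then Measure.dirac ∞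
  else (poissonMeasure t.toNNReal).map (fun n : ℕ => (n : ℝ≥0∞))

/-- `ξ` is a Poisson point process on `X` with intensity measure `m`: a random counting measure
(a measurable family of measures with values in `ℕ ∪ {∞}`) such that `ξ(A)` is Poisson with
parameter `m(A)` for each measurable set `A`, and `ξ(A₁), …, ξ(Aₙ)` are independent for pairwise
disjoint measurable sets `A₁, …, Aₙ`. -/
structure IsPoissonPointProcess {Ω X : Type*} [MeasurableSpace Ω] [MeasurableSpace X]
    (P : Measure Ω) (ξ : Ω → Measure X) (m : Measure X) : Prop where
  measurable : Measurable ξ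
  counting : ∀ (ω : Ω) (A : Set X), MeasurableSet A → ∃ n : ℕ∞, ξ ω A = (n : ℝ≥0∞)
  law : ∀ A : Set X, MeasurableSet A → P.map (fun ω => ξ ω A) = poissonLaw (m A)
  indep : ∀ (n : ℕ) (A : Fin n → Set X), (∀ i, MeasurableSet (A i)) →
    Pairwise (fun i j => Disjoint (A i) (A j)) → iIndepFun (fun i ω => ξ ω (A i)) P

section Cluster

variable {S : Type*} [MetricSpace S] [MeasurableSpace S]

/-- The open ball `B(z, R)` attached to a point `(z, R)` of `S × (0, ∞)`. -/
def markedBall (p : S × Set.Ioi (0 : ℝ)) : Set S := Metric.ball p.1 (p.2 : ℝ)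

/-- `p 0, …, p n` is a percolative chain for the configuration `ξ`: a finite sequence of points
of the support of `ξ` such that consecutive balls intersect. -/
def IsPercolativeChain (ξ : Measure (S × Set.Ioi (0 : ℝ))) (n : ℕ)
    (p : ℕ → S × Set.Ioi (0 : ℝ)) : Prop :=
  (∀ i ≤ n, p i ∈ ξ.support) ∧ ∀ i < n, (markedBall (p i) ∩ markedBall (p (i + 1))).Nonempty

/-- `x ↔ y`: the points `x` and `y` percolate each other. -/
def Percolates (ξ : Measure (S × Set.Ioi (0 : ℝ))) (x y : S) : Prop :=
  ∃ (n : ℕ) (p : ℕ → S × Set.Ioi (0 : ℝ)),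
    IsPercolativeChain ξ n p ∧ x ∈ markedBall (p 0) ∧ y ∈ markedBall (p n)

/-- The percolation cluster of `x`. -/
def cluster (ξ : Measure (S × Set.Ioi (0 : ℝ))) (x : S) : Set S := {y | Percolates ξ x y}

/-- `M(x) = sup {d(x, y) | y ∈ C(x)} ∈ [0, ∞]`, with `sup ∅ = 0`. -/
def clusterRadius (ξ : Measure (S × Set.Ioi (0 : ℝ))) (x : S) : ℝ≥0∞ :=
  ⨆ y ∈ cluster ξ x, edist x y

end Cluster

end BooleanPercolation

end

/-!
The proof is a renormalisation argument. Let `Crosses ξ x a` be the event that balls of the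
configuration with centre in `B(x, 10 a)` connect `B(x, a)` to the complement of the closed ball of
radius `8 a` around `x`. A crossing at scale `10 a` which uses no ball of radius larger than `a`
has to pass near the spheres of radius `10 a` and `70 a` around `x`, and near each of them it
contains a crossing at scale `a` around a point of an `a`-net
(`Crosses.exists_crosses_pair`). The two crossings live in disjoint regions and are therefore
independent. Since the space is doubling, the net has a bounded number `N ^ 7` of points, and
`f(a) = sup_x P(Crosses ξ x a)` satisfies `f(10 a) ≤ N ^ 14 f(a) ^ 2 + λ c ∫_{R > a} R ^ s ρ(dR)`
(`measure_crosses_ten_mul_le`).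

The volume bound gives `f(1) ≤ λ c'`, so for small `λ` all `f(10 ^ n)` are smaller than any
prescribed `ε`, and the inequality becomes linear with an arbitrarily small factor
(`exists_crossing_bounds`). Hence `f(10 ^ n) → 0`, and `∑ 10 ^ (β n) f(10 ^ n) < ∞` if `ρ` has a
moment of order `s + β`. Finally, `M(x) > 8 a` forces a crossing at scale `a` or a ball of
radius larger than `a` that comes close to `x` (`crosses_or_largeMarks_of_lt_clusterRadius`), and
both assertions follow.

Measurability and independence rest on two observations. An open set meets the support of `ξ` if
and only if `ξ` charges it, and paths can be moved into a countable dense set, so crossing events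
belong to the σ-algebra generated by the void events `{ξ(V) = 0}` with `V` in the relevant region.
Void events form a π-system, so independence of the counts of two disjoint sets extends to these
σ-algebras (`IsPoissonPointProcess.indep_voidSigma`).
-/

namespace BooleanPercolation

open Relation

/-! ### Paths of linked points -/

section Paths

variable {S : Type*} [MetricSpace S]

/-- The balls of radius larger than `a` which come close to `x` relative to their radius. -/
def largeMarks (x : S) (a : ℝ) : Set (S × Set.Ioi (0 : ℝ)) :=
  {p | dist p.1 x < 100 * (p.2 : ℝ) ∧ a < (p.2 : ℝ)}

variable [MeasurableSpace S]

/-- `y` and `z` lie in a common ball of the configuration `ξ` whose centre belongs to `A`. -/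
def Linked (ξ : Measure (S × Set.Ioi (0 : ℝ))) (A : Set S) (y z : S) : Prop :=
  ∃ p ∈ ξ.support, p.1 ∈ A ∧ y ∈ markedBall p ∧ z ∈ markedBall p

/-- The crossing event at scale `a`: the balls of the configuration with centre in `B(x, 10 a)`
connect `B(x, a)` to the complement of the closed ball of radius `8 a`. Both ends of the path are
required to lie in open sets, so that the path may be moved into a dense sequence. -/
def Crosses (ξ : Measure (S × Set.Ioi (0 : ℝ))) (x : S) (a : ℝ) : Prop :=
  ∃ y ∈ Metric.ball x a, ∃ z ∈ (Metric.closedBall x (8 * a))ᶜ,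
    ReflTransGen (Linked ξ (Metric.ball x (10 * a))) y z

theorem Linked.symm {ξ : Measure (S × Set.Ioi (0 : ℝ))} {A : Set S} {y z : S}
    (h : Linked ξ A y z) : Linked ξ A z y := by
  obtain ⟨p, hp, hA, hy, hz⟩ := h
  exact ⟨p, hp, hA, hz, hy⟩

theorem Percolates.reflTransGen_linked {ξ : Measure (S × Set.Ioi (0 : ℝ))} {x y : S}
    (h : Percolates ξ x y) : ReflTransGen (Linked ξ Set.univ) x y := by
  obtain ⟨n, p, hp, hx, hy⟩ := h
  induction n generalizing y with
  | zero => exact .single ⟨p 0, hp.1 0 le_rfl, trivial, hx, hy⟩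
  | succ n ih =>
    obtain ⟨w, hw, hw'⟩ := hp.2 n n.lt_succ_self
    exact (ih ⟨fun i hi => hp.1 i (by omega), fun i hi => hp.2 i (by omega)⟩ hw).tail
      ⟨p (n + 1), hp.1 _ le_rfl, trivial, hw', hy⟩

/-- Up to its first exit from the closed ball of radius `8 a` around `x`, a path started in
`B(x, a)` only uses balls which meet that closed ball. If these are centred in `B(x, 10 a)`, then
leaving the closed ball produces the crossing event. -/
theorem crosses_of_reflTransGen {ξ : Measure (S × Set.Ioi (0 : ℝ))} {A : Set S} {x y z : S} {a : ℝ}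
    (ha : 0 < a)
    (hloc : ∀ p ∈ ξ.support, p.1 ∈ A → ∀ w ∈ markedBall p, dist w x ≤ 8 * a →
      p.1 ∈ Metric.ball x (10 * a))
    (hyz : ReflTransGen (Linked ξ A) y z) (hy : dist y x < a) (hz : 8 * a < dist z x) :
    Crosses ξ x a := by
  have key : ∀ w, ReflTransGen (Linked ξ A) y w → Crosses ξ x a ∨
      (ReflTransGen (Linked ξ (Metric.ball x (10 * a))) y w ∧ dist w x ≤ 8 * a) := by
    intro w hw
    induction hw with
    | refl => exact .inr ⟨.refl, by linarith⟩
    | @tail b c _ hbc ih =>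
      refine ih.elim .inl fun ⟨hb, hbx⟩ => ?_
      obtain ⟨p, hp, hpA, hbp, hcp⟩ := hbc
      have hc := hb.tail (c := c) ⟨p, hp, hloc p hp hpA b hbp hbx, hbp, hcp⟩
      rcases le_or_gt (dist c x) (8 * a) with h | h
      · exact .inr ⟨hc, h⟩
      · exact .inl ⟨y, hy, c, by simpa using h, hc⟩
  exact (key z hyz).elim id fun h => absurd h.2 (not_le.2 hz)

/-- A discrete intermediate value property: a path through balls of radius at most `a` cannot
jump over an annulus of width `2 a`. -/
theorem exists_mem_annulus_of_reflTransGen {ξ : Measure (S × Set.Ioi (0 : ℝ))} {A : Set S}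
    {x y z : S} {a r : ℝ} (hsmall : ∀ p ∈ ξ.support, p.1 ∈ A → (p.2 : ℝ) ≤ a)
    (hyz : ReflTransGen (Linked ξ A) y z) (hy : dist y x < r) (hz : r ≤ dist z x) :
    ∃ w, ReflTransGen (Linked ξ A) y w ∧ ReflTransGen (Linked ξ A) w z ∧
      r ≤ dist w x ∧ dist w x < r + 2 * a := by
  induction hyz with
  | refl => exact absurd hy (not_lt.2 hz)
  | @tail b c hb hbc ih =>
    rcases le_or_gt r (dist b x) with h | h
    · obtain ⟨w, h1, h2, h3, h4⟩ := ih h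
      exact ⟨w, h1, h2.tail hbc, h3, h4⟩
    · refine ⟨c, hb.tail hbc, .refl, hz, ?_⟩
      obtain ⟨p, hp, hpA, hbp, hcp⟩ := hbc
      have := hsmall p hp hpA
      simp only [markedBall, Metric.mem_ball] at hbp hcp
      have := dist_triangle4_right c b p.1 p.1
      have := dist_triangle c b x
      have := dist_triangle_right c b p.1
      linarith

/-- One step of the renormalisation: a crossing at scale `10 a` which uses no ball of radius
larger than `a` forces crossings at scale `a` around two far apart points of any given `a`-net. -/
theorem Crosses.exists_crosses_pair {ξ : Measure (S × Set.Ioi (0 : ℝ))} {x : S} {a : ℝ}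
    (ha : 0 < a) {t : Finset S} (ht : Metric.ball x (80 * a) ⊆ ⋃ k ∈ t, Metric.ball k a)
    (h : Crosses ξ x (10 * a)) (hlarge : ¬ (ξ.support ∩ largeMarks x a).Nonempty) :
    ∃ k ∈ t, ∃ l ∈ t, Disjoint (Metric.ball k (10 * a)) (Metric.ball l (10 * a)) ∧
      Crosses ξ k a ∧ Crosses ξ l a := by
  obtain ⟨y, hy, z, hz, hyz⟩ := h
  rw [Metric.mem_ball] at hy
  rw [Set.mem_compl_iff, Metric.mem_closedBall, not_le] at hz
  set A := Metric.ball x (10 * (10 * a))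
  have hsmall : ∀ p ∈ ξ.support, p.1 ∈ A → (p.2 : ℝ) ≤ a := by
    intro p hp hpA
    by_contra! hlt
    rw [Metric.mem_ball] at hpA
    exact hlarge ⟨p, hp, by linarith, hlt⟩
  have hloc : ∀ k : S, ∀ p ∈ ξ.support, p.1 ∈ A → ∀ w ∈ markedBall p, dist w k ≤ 8 * a →
      p.1 ∈ Metric.ball k (10 * a) := by
    intro k p hp hpA w hw hwk
    have := hsmall p hp hpA
    simp only [markedBall, Metric.mem_ball] at hw ⊢
    have := dist_triangle_left p.1 k w
    linarith
  -- The path visits annuli at distances about `10 a` and `70 a`. Net points `k` and `l` nearby are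
  -- then more than `55 a` apart, and each end of the path used below is more than `8 a` away from
  -- the respective net point.
  obtain ⟨v, -, hvz, hv, hv'⟩ :=
    exists_mem_annulus_of_reflTransGen (x := x) (r := 10 * a) hsmall hyz hy (by linarith)
  obtain ⟨w, hyw, -, hw, hw'⟩ :=
    exists_mem_annulus_of_reflTransGen (x := x) (r := 70 * a) hsmall hyz (by linarith)
      (by linarith)
  have hv₀ : v ∈ Metric.ball x (80 * a) := by rw [Metric.mem_ball]; linarith
  have hw₀ : w ∈ Metric.ball x (80 * a) := by rw [Metric.mem_ball]; linarith
  obtain ⟨k, hk, hvk⟩ := Set.mem_iUnion₂.1 (ht hv₀)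
  obtain ⟨l, hl, hwl⟩ := Set.mem_iUnion₂.1 (ht hw₀)
  rw [Metric.mem_ball] at hvk hwl
  -- The path from `y` to `w` is followed backwards, from `w` towards the centre.
  have : Std.Symm (Linked ξ A) := ⟨fun _ _ => Linked.symm⟩
  have hwy : ReflTransGen (Linked ξ A) w y := Std.Symm.symm _ _ hyw
  refine ⟨k, hk, l, hl, ?_, crosses_of_reflTransGen ha (hloc k) hvz hvk ?_,
    crosses_of_reflTransGen ha (hloc l) hwy hwl ?_⟩
  · refine Metric.ball_disjoint_ball ?_
    have := dist_triangle w l x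
    have := dist_triangle l k x
    have := dist_triangle_left k x v
    rw [dist_comm k l]
    linarith
  · have := dist_triangle z k x
    have := dist_triangle_left k x v
    linarith
  · have := dist_triangle w l x
    have := dist_triangle_left l x y
    have := dist_comm l y
    linarith

/-- A large cluster is due to a crossing by nearby balls or to a large ball. -/
theorem crosses_or_largeMarks_of_lt_clusterRadius {ξ : Measure (S × Set.Ioi (0 : ℝ))} {x : S}
    {a : ℝ} (ha : 0 < a) (h : ENNReal.ofReal (8 * a) < clusterRadius ξ x) :
    Crosses ξ x a ∨ (ξ.support ∩ largeMarks x a).Nonempty := by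
  by_contra! hne
  obtain ⟨hcross, hlarge⟩ := hne
  simp only [clusterRadius, lt_iSup_iff] at h
  obtain ⟨y, hy, hxy⟩ := h
  rw [edist_dist, ENNReal.ofReal_lt_ofReal_iff_of_nonneg (by positivity), dist_comm] at hxy
  refine hcross (crosses_of_reflTransGen ha ?_ (Percolates.reflTransGen_linked hy)
    (by simpa using ha) hxy)
  -- A ball with centre at distance `d ≥ 10 a` from `x` which meets the closed ball of radius `8 a`
  -- has radius larger than `d - 8 a`, hence larger than `a` and than `d / 100`.
  intro p hp _ w hw hwx
  by_contra hpx
  simp only [markedBall, Metric.mem_ball, not_lt] at hw hpx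
  have := dist_triangle_left p.1 x w
  refine (Set.eq_empty_iff_forall_notMem.1 hlarge p) ⟨hp, ?_, ?_⟩ <;> linarith

end Paths

/-- Iterating the doubling property. -/
theorem exists_finset_cover_two_pow {S : Type*} [MetricSpace S] {N : ℕ}
    (hN : ∀ (x : S) (r : ℝ), 0 < r →
      ∃ t : Finset S, t.card ≤ N ∧ Metric.ball x r ⊆ ⋃ y ∈ t, Metric.ball y (r / 2))
    (k : ℕ) (x : S) {r : ℝ} (hr : 0 < r) :
    ∃ t : Finset S, t.card ≤ N ^ k ∧ Metric.ball x (2 ^ k * r) ⊆ ⋃ y ∈ t, Metric.ball y r := by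
  classical
  induction k generalizing x with
  | zero => exact ⟨{x}, by simp, by simp⟩
  | succ k ih =>
    choose t ht htc using ih
    obtain ⟨T, hT, hTc⟩ := hN x (2 ^ (k + 1) * r) (by positivity)
    refine ⟨T.biUnion t, ?_, fun y hy => ?_⟩
    · calc (T.biUnion t).card ≤ T.card * N ^ k :=
          Finset.card_biUnion_le_card_mul _ _ _ fun y _ => ht y
        _ ≤ N ^ (k + 1) := by rw [pow_succ']; gcongr
    · obtain ⟨w, hw, hyw⟩ := Set.mem_iUnion₂.1 (hTc hy)
      have h2 : (2 : ℝ) ^ (k + 1) * r / 2 = 2 ^ k * r := by ring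
      rw [h2] at hyw
      obtain ⟨v, hv, hyv⟩ := Set.mem_iUnion₂.1 (htc w hyw)
      exact Set.mem_iUnion₂.2 ⟨v, Finset.mem_biUnion.2 ⟨w, hw, hv⟩, hyv⟩

/-! ### Void events and their independence -/

section Void

variable {Ω X : Type*} [MeasurableSpace X]

/-- The σ-algebra generated by the void events `{ξ(V) = 0}`, `V ⊆ U` measurable. -/
@[reducible]
def voidSigma (ξ : Ω → Measure X) (U : Set X) : MeasurableSpace Ω :=
  MeasurableSpace.generateFrom {E | ∃ V ⊆ U, MeasurableSet V ∧ E = {ω | ξ ω V = 0}}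

theorem measurableSet_voidSigma_ne_zero {ξ : Ω → Measure X} {U V : Set X} (hVU : V ⊆ U)
    (hV : MeasurableSet V) :
    MeasurableSet[voidSigma ξ U] {ω | ξ ω V ≠ 0} :=
  MeasurableSet.compl (m := voidSigma ξ U) (s := {ω | ξ ω V = 0})
    (MeasurableSpace.measurableSet_generateFrom ⟨V, hVU, hV, rfl⟩)

theorem isPiSystem_void (ξ : Ω → Measure X) (U : Set X) :
    IsPiSystem {E | ∃ V ⊆ U, MeasurableSet V ∧ E = {ω | ξ ω V = 0}} := by
  rintro _ ⟨V, hVU, hV, rfl⟩ _ ⟨W, hWU, hW, rfl⟩ -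
  exact ⟨V ∪ W, Set.union_subset hVU hWU, hV.union hW, by ext; simp [measure_union_null_iff]⟩

variable [MeasurableSpace Ω] {P : Measure Ω} {ξ : Ω → Measure X} {m : Measure X}

theorem measurableSet_void (hξ : Measurable ξ) {V : Set X} (hV : MeasurableSet V) :
    MeasurableSet {ω | ξ ω V = 0} :=
  ((Measure.measurable_coe hV).comp hξ) (measurableSet_singleton 0)

theorem voidSigma_le (hξ : Measurable ξ) (U : Set X) :
    voidSigma ξ U ≤ (inferInstance : MeasurableSpace Ω) := by
  refine MeasurableSpace.generateFrom_le ?_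
  rintro _ ⟨V, -, hV, rfl⟩
  exact measurableSet_void hξ hV

/-- Over disjoint sets the configurations are independent. Void events suffice for this: they form
a π-system, since `{ξ(V) = 0} ∩ {ξ(W) = 0} = {ξ(V ∪ W) = 0}`. -/
theorem IsPoissonPointProcess.indep_voidSigma [IsProbabilityMeasure P]
    (h : IsPoissonPointProcess P ξ m) {U U' : Set X} (hU : Disjoint U U') :
    Indep (voidSigma ξ U) (voidSigma ξ U') P := by
  refine IndepSets.indep (voidSigma_le h.measurable U) (voidSigma_le h.measurable U')
    (isPiSystem_void ξ U) (isPiSystem_void ξ U') rfl rfl ?_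
  rw [IndepSets_iff]
  rintro _ _ ⟨V, hVU, hV, rfl⟩ ⟨W, hWU, hW, rfl⟩
  have hVW : Disjoint V W := hU.mono hVU hWU
  have hind := h.indep 2 ![V, W] (by simp [Fin.forall_fin_two, hV, hW]) (by
    intro i j hij
    fin_cases i <;> fin_cases j <;> simp_all [hVW.symm])
  exact (hind.indepFun (i := 0) (j := 1) (by decide)).measure_inter_preimage_eq_mul {0} {0}
    (measurableSet_singleton 0) (measurableSet_singleton 0)

theorem poissonLaw_compl_zero_le (t : ℝ≥0∞) : poissonLaw t {0}ᶜ ≤ t := by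
  rcases eq_or_ne t ∞ with rfl | ht
  · exact le_top
  lift t to ℝ≥0 using ht
  rw [poissonLaw, if_neg ENNReal.coe_ne_top, ENNReal.toNNReal_coe,
    Measure.map_apply .of_discrete (measurableSet_singleton 0).compl]
  have : ((fun n : ℕ => (n : ℝ≥0∞)) ⁻¹' {0}ᶜ) = {0}ᶜ := by ext; simp
  rw [this, prob_compl_eq_one_sub (measurableSet_singleton 0), poissonMeasure_singleton,
    tsub_le_iff_right, ← ENNReal.ofReal_coe_nnreal, ← ENNReal.ofReal_one,
    ← ENNReal.ofReal_add t.coe_nonneg (by positivity)]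
  refine ENNReal.ofReal_le_ofReal ?_
  simp only [pow_zero, Nat.factorial_zero, Nat.cast_one, mul_one, div_one]
  linarith [Real.add_one_le_exp (-(t : ℝ))]

/-- Markov's inequality for the number of points in a set. -/
theorem IsPoissonPointProcess.measure_ne_zero_le (h : IsPoissonPointProcess P ξ m) {V : Set X}
    (hV : MeasurableSet V) : P {ω | ξ ω V ≠ 0} ≤ m V := by
  refine le_trans (le_of_eq ?_) (poissonLaw_compl_zero_le (m V))
  have hmeas : Measurable fun ω => ξ ω V := (Measure.measurable_coe hV).comp h.measurable
  rw [← h.law V hV, Measure.map_apply hmeas (measurableSet_singleton 0).compl]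
  rfl

theorem support_inter_nonempty_iff [TopologicalSpace X] [HereditarilyLindelofSpace X]
    (ν : Measure X) {V : Set X} (hV : IsOpen V) : (ν.support ∩ V).Nonempty ↔ ν V ≠ 0 := by
  constructor
  · rintro ⟨p, hp, hpV⟩
    exact ((ν.mem_support_iff_forall p).1 hp V (hV.mem_nhds hpV)).ne'
  · intro h
    by_contra hne
    refine h (measure_mono_null (fun p hp hps => hne ⟨p, hps, hp⟩) ν.support_mem_ae)

end Void

/-- Connectedness in a random graph with countably many vertices is measurable. -/
theorem measurableSet_reflTransGen {Ω ι : Type*} [Countable ι] [MeasurableSpace Ω]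
    {r : Ω → ι → ι → Prop} (hr : ∀ i j, MeasurableSet {ω | r ω i j}) (i j : ι) :
    MeasurableSet {ω | ReflTransGen (r ω) i j} := by
  -- `step n j` is the event that `j` is reached from `i` by a path of length `n`.
  let step : ℕ → ι → Set Ω := fun n => Nat.rec (fun j => {_ω | i = j})
    (fun _ T j => ⋃ k, T k ∩ {ω | r ω k j}) n
  have hstep : ∀ n j, MeasurableSet (step n j) := by
    intro n
    induction n with
    | zero => exact fun j => .const _
    | succ n ih => exact fun j => .iUnion fun k => (ih k).inter (hr k j)
  have heq : {ω | ReflTransGen (r ω) i j} = ⋃ n, step n j := by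
    ext ω
    simp only [Set.mem_iUnion]
    constructor
    · intro h
      induction h with
      | refl => exact ⟨0, rfl⟩
      | tail _ hbc ih =>
        obtain ⟨n, hn⟩ := ih
        exact ⟨n + 1, Set.mem_iUnion.2 ⟨_, hn, hbc⟩⟩
    · rintro ⟨n, hn⟩
      induction n generalizing j with
      | zero => exact (show i = j from hn) ▸ ReflTransGen.refl
      | succ n ih =>
        obtain ⟨k, hk, hkj⟩ := Set.mem_iUnion.1 hn
        exact (ih k hk).tail hkj
  rw [heq]
  exact .iUnion fun n => hstep n j

/-! ### The crossing event is local -/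

section Measurability

variable {S : Type*} [MetricSpace S]

theorem isOpen_setOf_mem_markedBall (y : S) :
    IsOpen {p : S × Set.Ioi (0 : ℝ) | y ∈ markedBall p} := by
  simp only [markedBall, Metric.mem_ball]
  exact isOpen_lt (by fun_prop) (by fun_prop)

theorem isOpen_largeMarks (x : S) (a : ℝ) : IsOpen (largeMarks x a) := by
  have h1 : IsOpen {p : S × Set.Ioi (0 : ℝ) | dist p.1 x < 100 * (p.2 : ℝ)} :=
    isOpen_lt (by fun_prop) (by fun_prop)
  have h2 : IsOpen {p : S × Set.Ioi (0 : ℝ) | a < (p.2 : ℝ)} :=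
    isOpen_lt (by fun_prop) (by fun_prop)
  exact h1.inter h2

variable [MeasurableSpace S]

/-- A path can be moved into a dense sequence, keeping its ends in prescribed open sets. -/
theorem exists_reflTransGen_denseSeq [SecondCountableTopology S] [Nonempty S]
    {ξ : Measure (S × Set.Ioi (0 : ℝ))} {A : Set S} {y z : S}
    (h : ReflTransGen (Linked ξ A) y z) {V W : Set S} (hV : IsOpen V) (hy : y ∈ V)
    (hW : IsOpen W) (hz : z ∈ W) :
    ∃ i j, TopologicalSpace.denseSeq S i ∈ V ∧ TopologicalSpace.denseSeq S j ∈ W ∧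
      ReflTransGen (fun i j => Linked ξ A (TopologicalSpace.denseSeq S i)
        (TopologicalSpace.denseSeq S j)) i j := by
  have hd := TopologicalSpace.denseRange_denseSeq S
  induction h generalizing W with
  | refl =>
    obtain ⟨i, hi⟩ := hd.exists_mem_open (hV.inter hW) ⟨y, hy, hz⟩
    exact ⟨i, i, hi.1, hi.2, .refl⟩
  | @tail b c _ hbc ih =>
    obtain ⟨p, hp, hpA, hbp, hcp⟩ := hbc
    obtain ⟨i, j, hi, hj, hij⟩ := ih (W := markedBall p) Metric.isOpen_ball hbp
    obtain ⟨k, hk⟩ := hd.exists_mem_open (hW.inter (Metric.isOpen_ball (x := p.1) (ε := p.2)))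
      ⟨c, hz, hcp⟩
    exact ⟨i, k, hi, hk.1, hij.tail ⟨p, hp, hpA, hj, hk.2⟩⟩

/-- The crossing event depends only on the points with centre in `B(x, 10 a)`. -/
theorem measurableSet_crosses [SecondCountableTopology S] [BorelSpace S]
    {Ω : Type*} [MeasurableSpace Ω] (ξ : Ω → Measure (S × Set.Ioi (0 : ℝ))) (x : S) (a : ℝ) :
    MeasurableSet[voidSigma ξ (Prod.fst ⁻¹' Metric.ball x (10 * a))] {ω | Crosses (ξ ω) x a} := by
  have : Nonempty S := ⟨x⟩
  let d := TopologicalSpace.denseSeq S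
  let A := Metric.ball x (10 * a)
  have heq : {ω | Crosses (ξ ω) x a} = ⋃ i, ⋃ j, ⋃ (_ : d i ∈ Metric.ball x a),
      ⋃ (_ : d j ∈ (Metric.closedBall x (8 * a))ᶜ),
        {ω | ReflTransGen (fun i j => Linked (ξ ω) A (d i) (d j)) i j} := by
    ext ω
    simp only [Set.mem_iUnion, exists_prop]
    constructor
    · rintro ⟨y, hy, z, hz, hyz⟩
      obtain ⟨i, j, hi, hj, hij⟩ := exists_reflTransGen_denseSeq hyz Metric.isOpen_ball hy
        Metric.isClosed_closedBall.isOpen_compl hz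
      exact ⟨i, j, hi, hj, hij⟩
    · rintro ⟨i, j, hi, hj, (hij : ReflTransGen _ i j)⟩
      exact ⟨d i, hi, d j, hj, hij.lift d fun _ _ h => h⟩
  rw [heq]
  refine .iUnion fun i => .iUnion fun j => .iUnion fun _ => .iUnion fun _ =>
    @measurableSet_reflTransGen Ω ℕ _ (voidSigma ξ _) _ (fun k l => ?_) i j
  let U : Set (S × Set.Ioi (0 : ℝ)) :=
    Prod.fst ⁻¹' A ∩ ({p | d k ∈ markedBall p} ∩ {p | d l ∈ markedBall p})
  have hU : IsOpen U := (Metric.isOpen_ball.preimage continuous_fst).inter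
    ((isOpen_setOf_mem_markedBall _).inter (isOpen_setOf_mem_markedBall _))
  convert measurableSet_voidSigma_ne_zero (ξ := ξ) (Set.inter_subset_left : U ⊆ _)
    hU.measurableSet using 1
  ext ω
  exact (support_inter_nonempty_iff (ξ ω) hU)

end Measurability

/-! ### Recursive inequalities in `[0, ∞]` -/

theorem tendsto_zero_of_le_half_add {u b : ℕ → ℝ≥0∞} (h₀ : ∀ n, u n ≠ ∞)
    (h : ∀ n, u (n + 1) ≤ u n / 2 + b n) (hb : Tendsto b atTop (𝓝 0)) :
    Tendsto u atTop (𝓝 0) := by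
  rw [ENNReal.tendsto_nhds_zero] at hb ⊢
  intro ε hε
  obtain ⟨n₀, hn₀⟩ := eventually_atTop.1 (hb (ε / 2 / 2) (by simp [hε.ne']))
  have hk : ∀ k, u (n₀ + k) ≤ (1 / 2) ^ k * u n₀ + ε / 2 := by
    intro k
    induction k with
    | zero => simp
    | succ k ih =>
      calc u (n₀ + (k + 1)) ≤ u (n₀ + k) / 2 + b (n₀ + k) := h _
        _ ≤ ((1 / 2) ^ k * u n₀ + ε / 2) / 2 + ε / 2 / 2 := by
          gcongr
          exact hn₀ _ (by omega)
        _ = (1 / 2) ^ (k + 1) * u n₀ + ε / 2 := by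
          rw [ENNReal.add_div, add_assoc, ENNReal.add_halves, pow_succ]
          congr 1
          rw [div_eq_mul_inv, one_div]
          ring
  have hlim : Tendsto (fun k : ℕ => (1 / 2 : ℝ≥0∞) ^ k * u n₀) atTop (𝓝 0) := by
    have := ENNReal.Tendsto.mul_const (b := u n₀)
      (ENNReal.tendsto_pow_atTop_nhds_zero_of_lt_one (r := 1 / 2) (by simp)) (.inr (h₀ n₀))
    simpa using this
  obtain ⟨k₀, hk₀⟩ := eventually_atTop.1
    (ENNReal.tendsto_nhds_zero.1 hlim (ε / 2) (by simp [hε.ne']))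
  refine eventually_atTop.2 ⟨n₀ + k₀, fun n hn => ?_⟩
  obtain ⟨k, rfl⟩ := Nat.exists_eq_add_of_le (show n₀ ≤ n by omega)
  calc u (n₀ + k) ≤ (1 / 2) ^ k * u n₀ + ε / 2 := hk k
    _ ≤ ε / 2 + ε / 2 := by
      gcongr
      exact hk₀ k (by omega)
    _ = ε := ENNReal.add_halves ε

theorem tsum_ne_top_of_le_half_add {w b : ℕ → ℝ≥0∞} (h₀ : w 0 ≠ ∞)
    (h : ∀ n, w (n + 1) ≤ w n / 2 + b n) (hb : ∑' n, b n ≠ ∞) : ∑' n, w n ≠ ∞ := by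
  -- The extra term `2 * w n` makes the bound inductive without subtraction in `[0, ∞]`.
  have key : ∀ n, ∑ i ∈ Finset.range n, w i + 2 * w n ≤
      2 * w 0 + 2 * ∑ i ∈ Finset.range n, b i := by
    intro n
    induction n with
    | zero => simp
    | succ n ih =>
      rw [Finset.sum_range_succ, Finset.sum_range_succ]
      have h2 : 2 * w (n + 1) ≤ w n + 2 * b n := by
        refine (mul_le_mul_right (h n) 2).trans (le_of_eq ?_)
        rw [mul_add, ENNReal.mul_div_cancel (by simp) (by simp)]
      calc _ ≤ ∑ i ∈ Finset.range n, w i + w n + (w n + 2 * b n) := by gcongr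
        _ = ∑ i ∈ Finset.range n, w i + 2 * w n + 2 * b n := by ring
        _ ≤ 2 * w 0 + 2 * ∑ i ∈ Finset.range n, b i + 2 * b n := by gcongr
        _ = _ := by ring
  refine ne_top_of_le_ne_top (b := 2 * w 0 + 2 * ∑' n, b n) ?_ ?_
  · exact ENNReal.add_ne_top.2 ⟨ENNReal.mul_ne_top (by simp) h₀, ENNReal.mul_ne_top (by simp) hb⟩
  · rw [ENNReal.tsum_eq_iSup_nat]
    refine iSup_le fun n => (le_self_add.trans (key n)).trans ?_
    gcongr
    exact ENNReal.sum_le_tsum _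

/-! ### Tails of the radius distribution -/

/-- The truncated moment `∫_{R > a} R ^ s ρ(dR)`. -/
noncomputable def tailMoment (ρ : Measure (Set.Ioi (0 : ℝ))) (s a : ℝ) : ℝ≥0∞ :=
  ∫⁻ R in {R : Set.Ioi (0 : ℝ) | a < (R : ℝ)}, ENNReal.ofReal ((R : ℝ) ^ s) ∂ρ

theorem measurableSet_setOf_lt_coe (a : ℝ) :
    MeasurableSet {R : Set.Ioi (0 : ℝ) | a < (R : ℝ)} :=
  measurableSet_lt measurable_const measurable_subtype_coe

theorem measurable_ofReal_coe_rpow (s : ℝ) :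
    Measurable fun R : Set.Ioi (0 : ℝ) => ENNReal.ofReal ((R : ℝ) ^ s) :=
  ENNReal.measurable_ofReal.comp (measurable_subtype_coe.pow_const s)

variable {ρ : Measure (Set.Ioi (0 : ℝ))} {s : ℝ}

theorem tailMoment_le (ρ : Measure (Set.Ioi (0 : ℝ))) (s a : ℝ) :
    tailMoment ρ s a ≤ ∫⁻ R : Set.Ioi (0 : ℝ), ENNReal.ofReal ((R : ℝ) ^ s) ∂ρ :=
  setLIntegral_le_lintegral _ _

theorem tendsto_tailMoment [IsFiniteMeasure ρ]
    (h : (∫⁻ R : Set.Ioi (0 : ℝ), ENNReal.ofReal ((R : ℝ) ^ s) ∂ρ) ≠ ∞) :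
    Tendsto (fun n : ℕ => tailMoment ρ s (10 ^ n)) atTop (𝓝 0) := by
  refine tendsto_setLIntegral_zero h ?_
  have hempty : (⋂ n : ℕ, {R : Set.Ioi (0 : ℝ) | (10 : ℝ) ^ n < (R : ℝ)}) = ∅ := by
    refine Set.eq_empty_iff_forall_notMem.2 fun R hR => ?_
    obtain ⟨n, hn⟩ := pow_unbounded_of_one_lt (R : ℝ) (by norm_num : (1 : ℝ) < 10)
    exact lt_asymm hn (Set.mem_iInter.1 hR n)
  rw [← measure_empty (μ := ρ), ← hempty]
  refine tendsto_measure_iInter_atTop (fun n => (measurableSet_setOf_lt_coe _).nullMeasurableSet)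
    (fun m n hmn R (hR : (10 : ℝ) ^ n < R) => lt_of_le_of_lt ?_ hR) ⟨0, measure_ne_top _ _⟩
  exact pow_le_pow_right₀ (by norm_num) hmn

/-- The geometric sum `∑ q ^ n` over the scales `10 ^ n < R` is dominated by its last term. -/
theorem sum_indicator_pow_le {β R : ℝ} (hβ : 0 < β) (hR : 0 < R) (n : ℕ) :
    (∑ i ∈ Finset.range n, if (10 : ℝ) ^ i < R then ((10 : ℝ) ^ β) ^ i else 0) ≤
      (10 : ℝ) ^ β / ((10 : ℝ) ^ β - 1) * R ^ β := by
  set q : ℝ := (10 : ℝ) ^ β with hq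
  have hq1 : 1 < q := Real.one_lt_rpow (by norm_num) hβ
  have hq0 : 0 < q - 1 := by linarith
  induction n with
  | zero => simp; positivity
  | succ n ih =>
    by_cases hn : (10 : ℝ) ^ n < R
    · calc _ ≤ ∑ i ∈ Finset.range (n + 1), q ^ i :=
            Finset.sum_le_sum fun i _ => by split_ifs <;> first | exact le_rfl | positivity
        _ = (q ^ (n + 1) - 1) / (q - 1) := geom_sum_eq hq1.ne' _
        _ ≤ q ^ (n + 1) / (q - 1) := by gcongr; linarith
        _ = q / (q - 1) * q ^ n := by ring
        _ ≤ q / (q - 1) * R ^ β := by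
          gcongr
          rw [hq, Real.rpow_pow_comm (by norm_num)]
          gcongr
    · rw [Finset.sum_range_succ, if_neg hn, add_zero]
      exact ih

theorem tsum_mul_tailMoment_ne_top {β : ℝ} (hβ : 0 < β)
    (h : (∫⁻ R : Set.Ioi (0 : ℝ), ENNReal.ofReal ((R : ℝ) ^ (s + β)) ∂ρ) ≠ ∞) :
    ∑' n : ℕ, ENNReal.ofReal (((10 : ℝ) ^ β) ^ n) * tailMoment ρ s (10 ^ n) ≠ ∞ := by
  set q : ℝ := (10 : ℝ) ^ β with hq
  have hq1 : 1 < q := Real.one_lt_rpow (by norm_num) hβ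
  have hmeas := measurable_ofReal_coe_rpow s
  have hterm : ∀ n : ℕ, ENNReal.ofReal (q ^ n) * tailMoment ρ s (10 ^ n) =
      ∫⁻ R : Set.Ioi (0 : ℝ), {R : Set.Ioi (0 : ℝ) | (10 : ℝ) ^ n < (R : ℝ)}.indicator
        (fun R => ENNReal.ofReal (q ^ n) * ENNReal.ofReal ((R : ℝ) ^ s)) R ∂ρ := by
    intro n
    rw [lintegral_indicator (measurableSet_setOf_lt_coe _), lintegral_const_mul _ hmeas]
    rfl
  simp_rw [hterm]
  rw [← lintegral_tsum fun n => ((hmeas.const_mul _).indicator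
    (measurableSet_setOf_lt_coe _)).aemeasurable]
  refine ne_top_of_le_ne_top (ENNReal.mul_ne_top (ENNReal.ofReal_ne_top (r := q / (q - 1))) h) ?_
  rw [← lintegral_const_mul _ (measurable_ofReal_coe_rpow _)]
  refine lintegral_mono fun R => ?_
  have hR : 0 < (R : ℝ) := R.2
  rw [ENNReal.tsum_eq_iSup_nat]
  refine iSup_le fun n => ?_
  have hsum : ∀ i ∈ Finset.range n,
      {R : Set.Ioi (0 : ℝ) | (10 : ℝ) ^ i < (R : ℝ)}.indicator
        (fun R => ENNReal.ofReal (q ^ i) * ENNReal.ofReal ((R : ℝ) ^ s)) R =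
      ENNReal.ofReal ((if (10 : ℝ) ^ i < (R : ℝ) then q ^ i else 0) * (R : ℝ) ^ s) := by
    intro i _
    by_cases hi : (10 : ℝ) ^ i < (R : ℝ)
    · rw [Set.indicator_of_mem (by exact hi), if_pos hi, ENNReal.ofReal_mul (by positivity)]
    · rw [Set.indicator_of_notMem (by exact hi), if_neg hi, zero_mul, ENNReal.ofReal_zero]
  rw [Finset.sum_congr rfl hsum, ← ENNReal.ofReal_sum_of_nonneg
    (fun i _ => by split_ifs <;> positivity), ← Finset.sum_mul,
    ← ENNReal.ofReal_mul (div_nonneg (by positivity) (by linarith))]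
  refine ENNReal.ofReal_le_ofReal ?_
  rw [Real.rpow_add hR, mul_comm ((R : ℝ) ^ s), ← mul_assoc]
  gcongr
  exact sum_indicator_pow_le hβ hR n

theorem lintegral_rpow_ne_top_of_add [IsFiniteMeasure ρ] {β : ℝ} (hs : 0 < s) (hβ : 0 < β)
    (h : (∫⁻ R : Set.Ioi (0 : ℝ), ENNReal.ofReal ((R : ℝ) ^ (s + β)) ∂ρ) ≠ ∞) :
    (∫⁻ R : Set.Ioi (0 : ℝ), ENNReal.ofReal ((R : ℝ) ^ s) ∂ρ) ≠ ∞ := by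
  refine ne_top_of_le_ne_top (b := ∫⁻ R : Set.Ioi (0 : ℝ),
    (1 + ENNReal.ofReal ((R : ℝ) ^ (s + β))) ∂ρ) ?_ (lintegral_mono fun R => ?_)
  · rw [lintegral_add_left measurable_const, lintegral_one]
    exact ENNReal.add_ne_top.2 ⟨measure_ne_top _ _, h⟩
  · have hR : 0 < (R : ℝ) := R.2
    rw [← ENNReal.ofReal_one, ← ENNReal.ofReal_add zero_le_one (by positivity)]
    refine ENNReal.ofReal_le_ofReal ?_
    rcases le_total (R : ℝ) 1 with h1 | h1
    · have := Real.rpow_le_one hR.le h1 hs.le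
      have : 0 ≤ (R : ℝ) ^ (s + β) := by positivity
      linarith
    · have := Real.rpow_le_rpow_of_exponent_le h1 (by linarith : s ≤ s + β)
      linarith

/-! ### Probability estimates -/

section Estimates

variable {S : Type*} [MetricSpace S] [MeasurableSpace S] [BorelSpace S]
  {μ : Measure S} [IsProbabilityMeasure ρ] {C_V lam : ℝ}

theorem intensity_largeMarks_le [SFinite μ] (hC : 0 ≤ C_V) (hlam : 0 ≤ lam)
    (hvol : ∀ (x : S) (r : ℝ), 0 < r → μ (Metric.ball x r) ≤ ENNReal.ofReal (C_V * r ^ s))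
    (x : S) (a : ℝ) :
    ((ENNReal.ofReal lam • μ).prod ρ) (largeMarks x a) ≤
      ENNReal.ofReal (lam * C_V * 100 ^ s) * tailMoment ρ s a := by
  rw [Measure.prod_apply_symm (isOpen_largeMarks x a).measurableSet, tailMoment,
    ← lintegral_const_mul _ (measurable_ofReal_coe_rpow s),
    ← lintegral_indicator (measurableSet_setOf_lt_coe a)]
  refine lintegral_mono fun R => ?_
  have hR : 0 < (R : ℝ) := R.2
  by_cases haR : a < (R : ℝ)
  · rw [Set.indicator_of_mem (by exact haR)]
    calc (ENNReal.ofReal lam • μ) ((fun z => (z, R)) ⁻¹' largeMarks x a)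
        ≤ (ENNReal.ofReal lam • μ) (Metric.ball x (100 * R)) := measure_mono fun z hz => hz.1
      _ ≤ ENNReal.ofReal lam * ENNReal.ofReal (C_V * (100 * R) ^ s) := by
        rw [Measure.smul_apply, smul_eq_mul]
        gcongr
        exact hvol x _ (by positivity)
      _ = ENNReal.ofReal (lam * C_V * 100 ^ s) * ENNReal.ofReal ((R : ℝ) ^ s) := by
        rw [← ENNReal.ofReal_mul hlam, ← ENNReal.ofReal_mul (by positivity),
          Real.mul_rpow (by norm_num) hR.le]
        ring_nf
  · have : (fun z => (z, R)) ⁻¹' largeMarks x a = ∅ :=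
      Set.eq_empty_iff_forall_notMem.2 fun z hz => haR hz.2
    simp [this]

variable [SecondCountableTopology S] {Ω : Type*} [MeasurableSpace Ω] {P : Measure Ω}
  {ξ : Ω → Measure (S × Set.Ioi (0 : ℝ))}

theorem measurableSet_crosses' (hξ : Measurable ξ) (x : S) (a : ℝ) :
    MeasurableSet {ω | Crosses (ξ ω) x a} :=
  voidSigma_le hξ _ _ (measurableSet_crosses ξ x a)

theorem measure_largeMarks_le [SFinite μ]
    (h : IsPoissonPointProcess P ξ ((ENNReal.ofReal lam • μ).prod ρ)) (hC : 0 ≤ C_V)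
    (hlam : 0 ≤ lam)
    (hvol : ∀ (x : S) (r : ℝ), 0 < r → μ (Metric.ball x r) ≤ ENNReal.ofReal (C_V * r ^ s))
    (x : S) (a : ℝ) :
    P {ω | ((ξ ω).support ∩ largeMarks x a).Nonempty} ≤
      ENNReal.ofReal (lam * C_V * 100 ^ s) * tailMoment ρ s a := by
  simp_rw [support_inter_nonempty_iff _ (isOpen_largeMarks x a)]
  exact (h.measure_ne_zero_le (isOpen_largeMarks x a).measurableSet).trans
    (intensity_largeMarks_le hC hlam hvol x a)

/-- A crossing at scale `a` needs at least one point with centre in `B(x, 10 a)`. -/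
theorem measure_crosses_le (h : IsPoissonPointProcess P ξ ((ENNReal.ofReal lam • μ).prod ρ))
    (hlam : 0 ≤ lam)
    (hvol : ∀ (x : S) (r : ℝ), 0 < r → μ (Metric.ball x r) ≤ ENNReal.ofReal (C_V * r ^ s))
    (x : S) {a : ℝ} (ha : 0 < a) :
    P {ω | Crosses (ξ ω) x a} ≤ ENNReal.ofReal (lam * (C_V * (10 * a) ^ s)) := by
  have hopen : IsOpen (Metric.ball x (10 * a) ×ˢ (Set.univ : Set (Set.Ioi (0 : ℝ)))) :=
    Metric.isOpen_ball.prod isOpen_univ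
  calc P {ω | Crosses (ξ ω) x a}
      ≤ P {ω | ξ ω (Metric.ball x (10 * a) ×ˢ Set.univ) ≠ 0} := measure_mono fun ω hω => ?_
    _ ≤ ((ENNReal.ofReal lam • μ).prod ρ) (Metric.ball x (10 * a) ×ˢ Set.univ) :=
      h.measure_ne_zero_le hopen.measurableSet
    _ = ENNReal.ofReal lam * μ (Metric.ball x (10 * a)) := by simp
    _ ≤ ENNReal.ofReal lam * ENNReal.ofReal (C_V * (10 * a) ^ s) := by
      gcongr
      exact hvol x _ (by positivity)
    _ = _ := (ENNReal.ofReal_mul hlam).symm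
  rw [Set.mem_ofPred_eq, ← support_inter_nonempty_iff _ hopen]
  obtain ⟨y, hy, z, hz, hyz⟩ := hω
  rcases ReflTransGen.cases_head hyz with rfl | ⟨w, ⟨p, hp, hpx, -⟩, -⟩
  · rw [Metric.mem_ball] at hy
    rw [Set.mem_compl_iff, Metric.mem_closedBall, not_le] at hz
    linarith
  · exact ⟨p, hp, hpx, trivial⟩

/-- The renormalisation inequality: crossings at scale `10 a` are produced either by two
independent crossings at scale `a` or by a large ball. -/
theorem measure_crosses_ten_mul_le [SFinite μ] [IsProbabilityMeasure P]
    (h : IsPoissonPointProcess P ξ ((ENNReal.ofReal lam • μ).prod ρ)) (hC : 0 ≤ C_V)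
    (hlam : 0 ≤ lam)
    (hvol : ∀ (x : S) (r : ℝ), 0 < r → μ (Metric.ball x r) ≤ ENNReal.ofReal (C_V * r ^ s))
    {N : ℕ} (hN : ∀ (x : S) (r : ℝ), 0 < r →
      ∃ t : Finset S, t.card ≤ N ∧ Metric.ball x r ⊆ ⋃ y ∈ t, Metric.ball y (r / 2))
    {a : ℝ} (ha : 0 < a) {u : ℝ≥0∞} (hu : ∀ x, P {ω | Crosses (ξ ω) x a} ≤ u) (x : S) :
    P {ω | Crosses (ξ ω) x (10 * a)} ≤
      (N ^ 7 * N ^ 7 : ℕ) * (u * u) + ENNReal.ofReal (lam * C_V * 100 ^ s) * tailMoment ρ s a := by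
  classical
  -- Seven halvings lead from radius `80 a ≤ 2 ^ 7 * a` to radius `a`.
  obtain ⟨t, ht, htc⟩ := exists_finset_cover_two_pow hN 7 x ha
  have hcover : Metric.ball x (80 * a) ⊆ ⋃ k ∈ t, Metric.ball k a :=
    (Metric.ball_subset_ball (by linarith)).trans htc
  let T := (t ×ˢ t).filter fun kl =>
    Disjoint (Metric.ball kl.1 (10 * a)) (Metric.ball kl.2 (10 * a))
  have hsub : {ω | Crosses (ξ ω) x (10 * a)} ⊆
      (⋃ kl ∈ T, {ω | Crosses (ξ ω) kl.1 a} ∩ {ω | Crosses (ξ ω) kl.2 a}) ∪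
        {ω | ((ξ ω).support ∩ largeMarks x a).Nonempty} := by
    intro ω hω
    by_cases hlarge : ((ξ ω).support ∩ largeMarks x a).Nonempty
    · exact .inr hlarge
    · obtain ⟨k, hk, l, hl, hkl, hck, hcl⟩ := Crosses.exists_crosses_pair ha hcover hω hlarge
      exact .inl (Set.mem_iUnion₂.2 ⟨(k, l),
        Finset.mem_filter.2 ⟨Finset.mk_mem_product hk hl, hkl⟩, hck, hcl⟩)
  refine (measure_mono hsub).trans ((measure_union_le _ _).trans ?_)
  refine add_le_add ?_ (measure_largeMarks_le h hC hlam hvol x a)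
  have hpair : ∀ kl ∈ T,
      P ({ω | Crosses (ξ ω) kl.1 a} ∩ {ω | Crosses (ξ ω) kl.2 a}) ≤ u * u := by
    intro kl hkl
    have hdisj := (Finset.mem_filter.1 hkl).2
    rw [(Indep_iff _ _ _).1 (h.indep_voidSigma (hdisj.preimage Prod.fst)) _ _
      (measurableSet_crosses ξ kl.1 a) (measurableSet_crosses ξ kl.2 a)]
    exact mul_le_mul' (hu _) (hu _)
  calc _ ≤ ∑ kl ∈ T, P ({ω | Crosses (ξ ω) kl.1 a} ∩ {ω | Crosses (ξ ω) kl.2 a}) :=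
        measure_biUnion_finset_le _ _
    _ ≤ T.card • (u * u) := Finset.sum_le_card_nsmul _ _ _ hpair
    _ = (T.card : ℝ≥0∞) * (u * u) := nsmul_eq_mul _ _
    _ ≤ (N ^ 7 * N ^ 7 : ℕ) * (u * u) := by
      gcongr
      exact (Finset.card_filter_le _ _).trans (by rw [Finset.card_product]; gcongr)

/-- A measurable event which contains `{M(x) > 8 a}`. It serves as a substitute for this event,
which is not known to be measurable. -/
theorem exists_measurableSet_superset_clusterRadius [SFinite μ]
    (h : IsPoissonPointProcess P ξ ((ENNReal.ofReal lam • μ).prod ρ)) (hC : 0 ≤ C_V)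
    (hlam : 0 ≤ lam)
    (hvol : ∀ (x : S) (r : ℝ), 0 < r → μ (Metric.ball x r) ≤ ENNReal.ofReal (C_V * r ^ s))
    (x : S) {a : ℝ} (ha : 0 < a) :
    ∃ E : Set Ω, MeasurableSet E ∧
      {ω | ENNReal.ofReal (8 * a) < clusterRadius (ξ ω) x} ⊆ E ∧
      P E ≤ P {ω | Crosses (ξ ω) x a} +
        ENNReal.ofReal (lam * C_V * 100 ^ s) * tailMoment ρ s a := by
  refine ⟨{ω | Crosses (ξ ω) x a} ∪ {ω | ((ξ ω).support ∩ largeMarks x a).Nonempty}, ?_,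
    fun ω hω => crosses_or_largeMarks_of_lt_clusterRadius ha hω,
    (measure_union_le _ _).trans (by gcongr; exact measure_largeMarks_le h hC hlam hvol x a)⟩
  refine (measurableSet_crosses' h.measurable x a).union ?_
  simp_rw [support_inter_nonempty_iff _ (isOpen_largeMarks x a)]
  exact (measurableSet_void h.measurable (isOpen_largeMarks x a).measurableSet).compl

end Estimates

/-! ### Crossing probabilities along the scales `10 ^ n` -/

/-- For small intensity the crossing probabilities at the scales `10 ^ n` are so small that the
quadratic renormalisation inequality becomes a linear one with contraction factor `1 / (2 q)`. -/
theorem exists_crossing_bounds {S : Type*} [MetricSpace S] [MeasurableSpace S] [BorelSpace S]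
    [SecondCountableTopology S] {μ : Measure S} [SFinite μ]
    {ρ : Measure (Set.Ioi (0 : ℝ))} [IsProbabilityMeasure ρ] {C_V s : ℝ} (hC : 1 ≤ C_V)
    (hs : 0 < s)
    (hvol : ∀ (x : S) (r : ℝ), 0 < r → μ (Metric.ball x r) ≤ ENNReal.ofReal (C_V * r ^ s))
    (hdoubling : IsDoublingSpace S)
    (hmom : (∫⁻ R : Set.Ioi (0 : ℝ), ENNReal.ofReal ((R : ℝ) ^ s) ∂ρ) ≠ ∞)
    {q : ℝ} (hq : 1 ≤ q) :
    ∃ lam₀ : ℝ, 0 < lam₀ ∧ ∀ lam : ℝ, 0 < lam → lam < lam₀ →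
      ∀ (Ω : Type*) [MeasurableSpace Ω] (P : Measure Ω) [IsProbabilityMeasure P]
        (ξ : Ω → Measure (S × Set.Ioi (0 : ℝ))),
        IsPoissonPointProcess P ξ ((ENNReal.ofReal lam • μ).prod ρ) →
        ∃ u : ℕ → ℝ≥0∞, (∀ n, u n ≠ ∞) ∧
          (∀ n x, P {ω | Crosses (ξ ω) x (10 ^ n)} ≤ u n) ∧
          ∀ n, ENNReal.ofReal q * u (n + 1) ≤ u n / 2 + ENNReal.ofReal q *
            (ENNReal.ofReal (lam * C_V * 100 ^ s) * tailMoment ρ s (10 ^ n)) := by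
  obtain ⟨N, hN⟩ := hdoubling
  set K : ℕ := N ^ 7 * N ^ 7
  set H : ℝ := (∫⁻ R : Set.Ioi (0 : ℝ), ENNReal.ofReal ((R : ℝ) ^ s) ∂ρ).toReal with hH
  have hH0 : 0 ≤ H := ENNReal.toReal_nonneg
  -- If all crossing probabilities are at most `ε`, then `q * K * u ^ 2 ≤ u / 2`.
  set ε : ℝ := 1 / (2 * q * (K + 1)) with hε
  have hq0 : 0 < q := by linarith
  have hε0 : 0 < ε := by positivity
  have hKε : q * (K * ε) ≤ 1 / 2 := by
    rw [hε, show q * (K * (1 / (2 * q * ((K : ℝ) + 1)))) = (1 / 2) * (K / (K + 1)) by field_simp]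
    have : (K : ℝ) / (K + 1) ≤ 1 := (div_le_one (by positivity)).2 (by linarith)
    linarith
  have hKε' : K * ε ≤ 1 / 2 := (le_mul_of_one_le_left (by positivity) hq).trans hKε
  have h100 : (0 : ℝ) < 100 ^ s := by positivity
  refine ⟨ε / (2 * C_V * 100 ^ s * (H + 1)), by positivity, ?_⟩
  intro lam hlam hlam' Ω _ P _ ξ h
  rw [lt_div_iff₀ (by positivity)] at hlam'
  set c : ℝ := lam * C_V * 100 ^ s with hc
  have hc0 : 0 < c := by positivity
  have hcε : c ≤ ε / 2 := by nlinarith [mul_nonneg hc0.le hH0]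
  have hcH : c * H ≤ ε / 2 := by nlinarith
  let u : ℕ → ℝ≥0∞ := fun n => ⨆ x, P {ω | Crosses (ξ ω) x (10 ^ n)}
  have hu : ∀ n x, P {ω | Crosses (ξ ω) x (10 ^ n)} ≤ u n := fun n x =>
    le_iSup (fun x => P {ω | Crosses (ξ ω) x (10 ^ n)}) x
  have hrec : ∀ n, u (n + 1) ≤
      K * (u n * u n) + ENNReal.ofReal c * tailMoment ρ s (10 ^ n) := by
    intro n
    refine iSup_le fun x => ?_
    rw [pow_succ']
    exact measure_crosses_ten_mul_le h (by linarith) hlam.le hvol hN (by positivity) (hu n) x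
  have htail : ∀ n : ℕ, ENNReal.ofReal c * tailMoment ρ s (10 ^ n) ≤ ENNReal.ofReal (ε / 2) := by
    intro n
    calc _ ≤ ENNReal.ofReal c * ENNReal.ofReal H := by
          rw [hH, ENNReal.ofReal_toReal hmom]
          gcongr
          exact tailMoment_le ρ s _
      _ = ENNReal.ofReal (c * H) := (ENNReal.ofReal_mul hc0.le).symm
      _ ≤ _ := ENNReal.ofReal_le_ofReal hcH
  have hKcast : (K : ℝ≥0∞) = ENNReal.ofReal K := (ENNReal.ofReal_natCast K).symm
  have hsmall : ∀ n, u n ≤ ENNReal.ofReal ε := by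
    intro n
    induction n with
    | zero =>
      refine iSup_le fun x => (measure_crosses_le h hlam.le hvol x (by positivity)).trans
        (ENNReal.ofReal_le_ofReal ?_)
      have : ((10 : ℝ) * 10 ^ 0) ^ s ≤ 100 ^ s := by gcongr; norm_num
      calc lam * (C_V * (10 * 10 ^ 0) ^ s) ≤ lam * (C_V * 100 ^ s) := by gcongr
        _ = c := by ring
        _ ≤ ε := by linarith
    | succ n ih =>
      calc u (n + 1) ≤ K * (u n * u n) + ENNReal.ofReal c * tailMoment ρ s (10 ^ n) := hrec n
        _ ≤ ENNReal.ofReal K * (ENNReal.ofReal ε * ENNReal.ofReal ε) + ENNReal.ofReal (ε / 2) := by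
          rw [hKcast]
          gcongr
          exact htail n
        _ = ENNReal.ofReal (K * (ε * ε) + ε / 2) := by
          rw [← ENNReal.ofReal_mul hε0.le, ← ENNReal.ofReal_mul (by positivity),
            ← ENNReal.ofReal_add (by positivity) (by positivity)]
        _ ≤ ENNReal.ofReal ε := ENNReal.ofReal_le_ofReal (by nlinarith)
  refine ⟨u, fun n => ne_top_of_le_ne_top ENNReal.ofReal_ne_top (hsmall n), hu, fun n => ?_⟩
  calc ENNReal.ofReal q * u (n + 1)
      ≤ ENNReal.ofReal q * (ENNReal.ofReal K * (ENNReal.ofReal ε * u n) +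
          ENNReal.ofReal c * tailMoment ρ s (10 ^ n)) := by
        rw [← hKcast]
        gcongr
        refine (hrec n).trans ?_
        gcongr
        exact hsmall n
    _ = ENNReal.ofReal (q * (K * ε)) * u n +
          ENNReal.ofReal q * (ENNReal.ofReal c * tailMoment ρ s (10 ^ n)) := by
        rw [ENNReal.ofReal_mul (p := q) hq0.le, ENNReal.ofReal_mul (p := (K : ℝ)) (by positivity)]
        ring
    _ ≤ u n / 2 + ENNReal.ofReal q * (ENNReal.ofReal c * tailMoment ρ s (10 ^ n)) := by
        gcongr
        calc ENNReal.ofReal (q * (K * ε)) * u n ≤ ENNReal.ofReal (1 / 2) * u n := by gcongr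
          _ = u n / 2 := by
            rw [ENNReal.ofReal_div_of_pos (by norm_num), ENNReal.ofReal_one, one_div, mul_comm,
              div_eq_mul_inv]
            simp

/-- Decomposition of a power of `M` along the scales `8 * 10 ^ n`. -/
theorem rpow_le_add_tsum {β : ℝ} (hβ : 0 < β) (M : ℝ≥0∞) :
    M ^ β ≤ ENNReal.ofReal (8 ^ β) + ∑' n : ℕ, if ENNReal.ofReal (8 * 10 ^ n) < M then
      ENNReal.ofReal (80 ^ β) * ENNReal.ofReal (((10 : ℝ) ^ β) ^ n) else 0 := by
  by_cases hex : ∃ n : ℕ, M ≤ ENNReal.ofReal (8 * 10 ^ n)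
  · classical
    have hle := Nat.find_spec hex
    have hmin := fun m => Nat.find_min (m := m) hex
    obtain ⟨m, hm⟩ : ∃ m, Nat.find hex = m := ⟨_, rfl⟩
    rw [hm] at hle hmin
    rcases m with _ | m
    · refine le_add_right ((ENNReal.rpow_le_rpow hle hβ.le).trans (le_of_eq ?_))
      rw [ENNReal.ofReal_rpow_of_nonneg (by positivity) hβ.le]
      simp
    · refine le_add_left (le_trans ?_ (ENNReal.le_tsum m))
      rw [if_pos (not_le.1 (hmin m m.lt_succ_self))]
      refine (ENNReal.rpow_le_rpow hle hβ.le).trans (le_of_eq ?_)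
      rw [ENNReal.ofReal_rpow_of_nonneg (by positivity) hβ.le, ← ENNReal.ofReal_mul (by positivity),
        Real.rpow_pow_comm (by norm_num), ← Real.mul_rpow (by norm_num) (by positivity)]
      congr 2
      ring
  · -- Here `M = ∞`, and every term of the series is at least `1`.
    push Not at hex
    have htop : ∑' n : ℕ, (if ENNReal.ofReal (8 * 10 ^ n) < M then
        ENNReal.ofReal (80 ^ β) * ENNReal.ofReal (((10 : ℝ) ^ β) ^ n) else 0) = ∞ := by
      refine top_le_iff.1 ((ENNReal.tsum_const_eq_top_of_ne_zero (α := ℕ) one_ne_zero).ge.trans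
        (ENNReal.tsum_le_tsum fun n => ?_))
      rw [if_pos (hex n), ← ENNReal.ofReal_mul (by positivity), ← ENNReal.ofReal_one]
      refine ENNReal.ofReal_le_ofReal ?_
      exact one_le_mul_of_one_le_of_one_le (Real.one_le_rpow (by norm_num) hβ.le)
        (one_le_pow₀ (Real.one_le_rpow (by norm_num) hβ.le))
    rw [htop, add_top]
    exact le_top

end BooleanPercolation

theorem mainTheorem2 {S : Type*} [MetricSpace S] [LocallyCompactSpace S]
    [TopologicalSpace.SeparableSpace S] [MeasurableSpace S] [BorelSpace S]
    (hunbdd : ¬ Bornology.IsBounded (Set.univ : Set S))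
    (σ : ℝ) (hσ : 1 < σ)
    (hdoubling : BooleanPercolation.IsDoublingSpace S)
    (hperfect : BooleanPercolation.IsUniformlyPerfect S σ)
    (μ : Measure S) (hμ_infinite : μ Set.univ = ∞)
    (hμ_finite : BooleanPercolation.IsBoundedlyFinite μ)
    (ρ : Measure (Set.Ioi (0 : ℝ))) [IsProbabilityMeasure ρ]
    (C_V s : ℝ) (hC_V : 1 ≤ C_V) (hs : 0 < s)
    (hvol : ∀ (x : S) (r : ℝ), 0 < r → μ (Metric.ball x r) ≤ ENNReal.ofReal (C_V * r ^ s)) :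
    ((∫⁻ R : Set.Ioi (0 : ℝ), ENNReal.ofReal ((R : ℝ) ^ s) ∂ρ) < ∞ →
      ∃ lam₀ : ℝ, 0 < lam₀ ∧ ∀ lam : ℝ, 0 < lam → lam < lam₀ →
        ∀ (Ω : Type*) [MeasurableSpace Ω] (P : Measure Ω) [IsProbabilityMeasure P]
          (ξ : Ω → Measure (S × Set.Ioi (0 : ℝ))),
          BooleanPercolation.IsPoissonPointProcess P ξ ((ENNReal.ofReal lam • μ).prod ρ) →
          Tendsto
            (fun r : ℝ =>
              ⨆ x : S, P {ω | ENNReal.ofReal r < BooleanPercolation.clusterRadius (ξ ω) x})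
            atTop (𝓝 0)) ∧
    (∀ β : ℝ, 0 < β →
      (∫⁻ R : Set.Ioi (0 : ℝ), ENNReal.ofReal ((R : ℝ) ^ (s + β)) ∂ρ) < ∞ →
      ∃ lam₀ : ℝ, 0 < lam₀ ∧ ∀ lam : ℝ, 0 < lam → lam < lam₀ →
        ∀ (Ω : Type*) [MeasurableSpace Ω] (P : Measure Ω) [IsProbabilityMeasure P]
          (ξ : Ω → Measure (S × Set.Ioi (0 : ℝ))),
          BooleanPercolation.IsPoissonPointProcess P ξ ((ENNReal.ofReal lam • μ).prod ρ) →
          (⨆ x : S, ∫⁻ ω, BooleanPercolation.clusterRadius (ξ ω) x ^ β ∂P) < ∞) := by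
  open BooleanPercolation in
  have : SecondCountableTopology S := UniformSpace.secondCountable_of_separable S
  have : IsLocallyFiniteMeasure μ :=
    ⟨fun x => ⟨Metric.ball x 1, Metric.ball_mem_nhds x one_pos,
      hμ_finite _ measurableSet_ball Metric.isBounded_ball⟩⟩
  have hC0 : 0 ≤ C_V := by linarith
  refine ⟨fun hmom => ?_, fun β hβ hmomβ => ?_⟩
  · obtain ⟨lam₀, hlam₀, hmain⟩ :=
      exists_crossing_bounds hC_V hs hvol hdoubling hmom.ne le_rfl
    refine ⟨lam₀, hlam₀, fun lam hlam hlam' Ω _ P _ ξ h => ?_⟩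
    obtain ⟨u, hutop, hu, hrec⟩ := hmain lam hlam hlam' Ω P ξ h
    set b : ℕ → ℝ≥0∞ := fun n => ENNReal.ofReal (lam * C_V * 100 ^ s) * tailMoment ρ s (10 ^ n)
      with hb
    have hb0 : Tendsto b atTop (𝓝 0) := by
      simpa using ENNReal.Tendsto.const_mul (tendsto_tailMoment hmom.ne)
        (.inr (ENNReal.ofReal_ne_top (r := lam * C_V * 100 ^ s)))
    have hu0 : Tendsto u atTop (𝓝 0) :=
      tendsto_zero_of_le_half_add hutop (by simpa using hrec) hb0
    have hub : Tendsto (fun n => u n + b n) atTop (𝓝 0) := by simpa using hu0.add hb0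
    rw [ENNReal.tendsto_nhds_zero] at hub ⊢
    intro ε hε
    obtain ⟨n, hn⟩ := (hub ε hε).exists
    filter_upwards [eventually_ge_atTop (8 * 10 ^ n : ℝ)] with r hr
    refine iSup_le fun x => ?_
    obtain ⟨E, -, hsub, hPE⟩ := exists_measurableSet_superset_clusterRadius h hC0 hlam.le hvol x
      (show (0 : ℝ) < 10 ^ n by positivity)
    refine (measure_mono (Set.Subset.trans (fun ω hω => ?_) hsub)).trans (hPE.trans ?_)
    · exact lt_of_le_of_lt (ENNReal.ofReal_le_ofReal hr) hω
    · exact le_trans (by gcongr; exact hu n x) hn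
  · have hmom := lintegral_rpow_ne_top_of_add hs hβ hmomβ.ne
    set q : ℝ := (10 : ℝ) ^ β with hq
    have hq1 : 1 ≤ q := Real.one_le_rpow (by norm_num) hβ.le
    have hq0 : 0 ≤ q := by linarith
    obtain ⟨lam₀, hlam₀, hmain⟩ :=
      exists_crossing_bounds hC_V hs hvol hdoubling hmom hq1
    refine ⟨lam₀, hlam₀, fun lam hlam hlam' Ω _ P _ ξ h => ?_⟩
    obtain ⟨u, hutop, hu, hrec⟩ := hmain lam hlam hlam' Ω P ξ h
    set c : ℝ≥0∞ := ENNReal.ofReal (lam * C_V * 100 ^ s) with hc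
    have hbsum : ∑' n : ℕ, ENNReal.ofReal (q ^ n) * (c * tailMoment ρ s (10 ^ n)) ≠ ∞ := by
      simp_rw [mul_left_comm _ c, ENNReal.tsum_mul_left]
      exact ENNReal.mul_ne_top ENNReal.ofReal_ne_top (tsum_mul_tailMoment_ne_top hβ hmomβ.ne)
    have husum : ∑' n : ℕ, ENNReal.ofReal (q ^ n) * u n ≠ ∞ := by
      refine tsum_ne_top_of_le_half_add
        (b := fun n => ENNReal.ofReal q *
          (ENNReal.ofReal (q ^ n) * (c * tailMoment ρ s (10 ^ n))))
        (by simpa using hutop 0) (fun n => ?_) ?_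
      · calc ENNReal.ofReal (q ^ (n + 1)) * u (n + 1)
            = ENNReal.ofReal (q ^ n) * (ENNReal.ofReal q * u (n + 1)) := by
              rw [pow_succ, ENNReal.ofReal_mul (by positivity), mul_assoc]
          _ ≤ ENNReal.ofReal (q ^ n) *
              (u n / 2 + ENNReal.ofReal q * (c * tailMoment ρ s (10 ^ n))) := by
              gcongr
              exact hrec n
          _ = _ := by
              rw [mul_add, mul_div_assoc,
                mul_left_comm (ENNReal.ofReal q) (ENNReal.ofReal (q ^ n))]
      · rw [ENNReal.tsum_mul_left]
        exact ENNReal.mul_ne_top ENNReal.ofReal_ne_top hbsum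
    refine lt_of_le_of_lt (b := ENNReal.ofReal (8 ^ β) + ∑' n : ℕ,
      ENNReal.ofReal (80 ^ β) * ENNReal.ofReal (q ^ n) * (u n + c * tailMoment ρ s (10 ^ n)))
      (iSup_le fun x => ?_) ?_
    · choose E hEm hsub hPE using fun n : ℕ =>
        exists_measurableSet_superset_clusterRadius h hC0 hlam.le hvol x
          (show (0 : ℝ) < 10 ^ n by positivity)
      calc ∫⁻ ω, clusterRadius (ξ ω) x ^ β ∂P
          ≤ ∫⁻ ω, (ENNReal.ofReal (8 ^ β) + ∑' n : ℕ, (E n).indicator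
              (fun _ => ENNReal.ofReal (80 ^ β) * ENNReal.ofReal (q ^ n)) ω) ∂P := by
            refine lintegral_mono fun ω => (rpow_le_add_tsum hβ _).trans ?_
            gcongr with n
            split_ifs with hn
            · rw [Set.indicator_of_mem (hsub n hn)]
            · exact zero_le
        _ = ENNReal.ofReal (8 ^ β) + ∑' n : ℕ,
              ENNReal.ofReal (80 ^ β) * ENNReal.ofReal (q ^ n) * P (E n) := by
            rw [lintegral_add_left measurable_const, lintegral_const, measure_univ, mul_one,
              lintegral_tsum fun n => (measurable_const.indicator (hEm n)).aemeasurable]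
            simp_rw [lintegral_indicator_const (hEm _)]
        _ ≤ _ := by
            gcongr with n
            exact (hPE n).trans (by gcongr; exact hu n x)
    · simp_rw [mul_assoc, ENNReal.tsum_mul_left, mul_add]
      rw [ENNReal.tsum_add]
      exact ENNReal.add_lt_top.2 ⟨ENNReal.ofReal_lt_top, ENNReal.mul_lt_top ENNReal.ofReal_lt_top
        (ENNReal.add_lt_top.2 ⟨husum.lt_top, hbsum.lt_top⟩)⟩
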